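/- An $n\times n$ grayscale image $M$ assigns to each pixel $p\in\{1,\dots,n\}^2$ a value $M(p)\in[0,1]$. Two different pixels are adjacent if each coordinate differs by at most $1$; the gradient of a pixel is the largest absolute difference between its value and the value of an adjacent pixel, and the perimeter size $P_M$ is the sum of the gradients of all pixels, where each outermost pixel is counted as $1$. Fix constants $c,\kappa\ge 1$. An image-affine transformation is a map $T(p)=\lfloor Ap+t\rfloor$ (rounding down coordinatewise), with $t\in\mathbb R^2$ and $A\in\mathbb R^{2\times 2}$ such that $\|v\|/c\le\|Av\|\le c\|v\|$ for all $v\in\mathbb{R}^2$ (Euclidean norm). An intensity transformation is a map $L(v)=\max(0,\min(1,\mathrm{con}\cdot v+\mathrm{bri}))$ with $\mathrm{con}\in[1/\kappa,\kappa]$ and $\mathrm{bri}\in[-\kappa,1]$. For $n\times n$ images $M_1,M_2$ let $$\Delta_{T,L}(M_1,M_2)=\frac1{n^2}\sum_{p\in\{1,\dots,n\}^2}\begin{cases}|M_1(p)-L(M_2(T(p)))| & \text{if } T(p)\in\{1,\dots,n\}^2,\\ 1 & \text{otherwise,}\end{cases}$$ and let $\Delta(M_1,M_2)$ be the minimum of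 $\Delta_{T,L}(M_1,M_2)$ over all such $T$ and $L$. **Corollary.** For images with $P_{M_1}=O(n)$ and $P_{M_2}=O(n)$, the distance $\Delta(M_1,M_2)$ can be approximated with high probability to within an additive error $O(\delta+\varepsilon)$ using $\tilde O(1/(\varepsilon^2\delta^8))$ queries, independently of $n$. Precisely: for every $B$ there is a constant $K_B$ (depending only on $B,c,\kappa$), and for every $\eta\in(0,1)$ there are constants $C,k$ (depending only on $\eta,c,\kappa$), such that for all $n\ge1$, $\delta>0$, $\varepsilon>0$ there is a randomized adaptive algorithm with query access to the pixel values of two $n\times n$ grayscale images that, with $X=1/(\varepsilon^2\delta^8)$, always makes at most $C\,X\,\log(2+X)^k$ queries and that, for every $B$ and all images $M_1,M_2$ with $P_{M_1}\le Bn$ and $P_{M_2}\le Bn$, outputs with probability at least $1-\eta$ a number $d$ with $|d-\Delta(M_1,M_2)|\le K_B(\delta+\varepsilon)$. -/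

import Mathlib

namespace ImageMatching

/-! ### Grayscale images and their perimeter size -/

/-- The pixel positions `{1, …, n}²` of an `n × n` image. -/
noncomputable def pixels (n : ℕ) : Finset (ℤ × ℤ) :=
  Finset.Icc (1 : ℤ) (n : ℤ) ×ˢ Finset.Icc (1 : ℤ) (n : ℤ)

/-- A pixel of an `n × n` image. -/
abbrev Pixel (n : ℕ) : Type := {p : ℤ × ℤ // p ∈ pixels n}

/-- An `n × n` grayscale image: every pixel has a value in `[0, 1]`. -/
abbrev GrayImage (n : ℕ) : Type := Pixel n → Set.Icc (0 : ℝ) 1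

/-- Two different pixels are adjacent if both coordinates differ by at most one. -/
def Adjacent {n : ℕ} (p q : Pixel n) : Prop :=
  p ≠ q ∧ |p.1.1 - q.1.1| ≤ 1 ∧ |p.1.2 - q.1.2| ≤ 1

/-- The gradient of a pixel: the largest absolute difference to the value of an adjacent pixel
(a supremum over a finite set; it is `0` if there is no adjacent pixel). -/
noncomputable def gradient {n : ℕ} (M : GrayImage n) (p : Pixel n) : ℝ :=
  ⨆ q : {q : Pixel n // Adjacent p q}, |(M p : ℝ) - (M q.1 : ℝ)|

/-- The outermost pixels of the square image. -/
def IsOutermost {n : ℕ} (p : Pixel n) : Prop :=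
  p.1.1 = 1 ∨ p.1.1 = (n : ℤ) ∨ p.1.2 = 1 ∨ p.1.2 = (n : ℤ)

open Classical in
/-- The perimeter size of a grayscale image: the sum of the gradients of its pixels, where each
outermost pixel counts as `1`. -/
noncomputable def perimeterSize {n : ℕ} (M : GrayImage n) : ℝ :=
  ∑ p : Pixel n, if IsOutermost p then 1 else gradient M p

/-! ### Transformations and the distance between images -/

/-- (The data of) an image-affine transformation `p ↦ ⌊A p + t⌋` whose matrix has scaling factor
in `[1/c, c]` with respect to the Euclidean norm; for `c > 0` such a matrix is non-singular. -/
structure ImageAffine (c : ℝ) where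
  A : Matrix (Fin 2) (Fin 2) ℝ
  t : Fin 2 → ℝ
  scaling : ∀ v : EuclideanSpace ℝ (Fin 2),
    ‖v‖ / c ≤ ‖Matrix.toEuclideanLin A v‖ ∧ ‖Matrix.toEuclideanLin A v‖ ≤ c * ‖v‖

/-- The action `p ↦ ⌊A p + t⌋` on integer points (rounding down each coordinate). -/
noncomputable def ImageAffine.apply {c : ℝ} (T : ImageAffine c) (p : ℤ × ℤ) : ℤ × ℤ :=
  (⌊T.A.mulVec ![(p.1 : ℝ), (p.2 : ℝ)] 0 + T.t 0⌋,
   ⌊T.A.mulVec ![(p.1 : ℝ), (p.2 : ℝ)] 1 + T.t 1⌋)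

/-- An intensity transformation, with contrast factor in `[1/κ, κ]` and brightness summand in
`[-κ, 1]`. -/
structure Intensity (κ : ℝ) where
  con : ℝ
  bri : ℝ
  con_mem : con ∈ Set.Icc (1 / κ) κ
  bri_mem : bri ∈ Set.Icc (-κ) 1

/-- The action `v ↦ con · v + bri`, truncated to `[0, 1]`. -/
noncomputable def Intensity.apply {κ : ℝ} (L : Intensity κ) (v : ℝ) : ℝ :=
  max 0 (min 1 (L.con * v + L.bri))

/-- The distance `Δ_{T,L}(M₁, M₂)`: the average over the pixels `p` of `M₁` of
`|M₁(p) - L(M₂(T(p)))|`, where pixels mapped outside `M₂` contribute `1`. -/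
noncomputable def distWith {c κ : ℝ} {n : ℕ} (T : ImageAffine c) (L : Intensity κ)
    (M₁ M₂ : GrayImage n) : ℝ :=
  1 / (n : ℝ) ^ 2 * ∑ p : Pixel n,
    if h : T.apply p.1 ∈ pixels n then |(M₁ p : ℝ) - L.apply (M₂ ⟨T.apply p.1, h⟩ : ℝ)| else 1

/-- The distance `Δ(M₁, M₂)`: the minimum of `Δ_{T,L}(M₁, M₂)` over all image-affine
transformations `T` and all intensity transformations `L`. -/
noncomputable def imageDist (c κ : ℝ) {n : ℕ} (M₁ M₂ : GrayImage n) : ℝ :=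
  ⨅ TL : ImageAffine c × Intensity κ, distWith TL.1 TL.2 M₁ M₂

/-! ### Randomized query algorithms -/

/-- Randomized adaptive algorithms with query access to two `n × n` grayscale images which return
a real number. An algorithm stops with an output, or queries a pixel of the first
(`false`) or second (`true`) image and goes on depending on the answer, or draws
a uniformly random element of `{0, …, m}` and goes on depending on it. -/
inductive QueryAlg (n : ℕ) : Type where
  | output (d : ℝ) : QueryAlg n
  | query (second : Bool) (p : Pixel n) (next : Set.Icc (0 : ℝ) 1 → QueryAlg n) : QueryAlg n
  | random (m : ℕ) (next : Fin (m + 1) → QueryAlg n) : QueryAlg n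

/-- The distribution of the output when the algorithm is run on the images `M₁, M₂`. -/
noncomputable def QueryAlg.run {n : ℕ} (M₁ M₂ : GrayImage n) : QueryAlg n → PMF ℝ
  | .output d => PMF.pure d
  | .query second p next => (next (if second then M₂ p else M₁ p)).run M₁ M₂
  | .random m next => (PMF.uniformOfFintype (Fin (m + 1))).bind fun i => (next i).run M₁ M₂

/-- On every run (for all answers and all random choices) the algorithm makes at most `q`
queries. -/
def QueryAlg.QueriesAtMost {n : ℕ} : QueryAlg n → ℕ → Prop
  | .output _, _ => True
  | .query _ _ _, 0 => False
  | .query _ _ next, q + 1 => ∀ a, (next a).QueriesAtMost q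
  | .random _ next, q => ∀ i, (next i).QueriesAtMost q

end ImageMatching

/-! The distance varies slowly with the transformation when the second image has small perimeter
size. If the entries of `A` move by at most `δ` and `t` by at most `δ * n`, then every point `A p +
t` with `p` a pixel moves by `O(δ n)` in each coordinate. Split the straight path between the two
maps into `O(δ n)` steps, each moving a rounded point at most to an adjacent one. A step changes the
cost of `p` by at most `κ` times the gradients at its two ends (`abs_costAt_sub_costAt_le`). Every
map on the path is boundedly-many-to-one (`ImageAffine.card_fiber_le`), so summing over `p` gives
`O(B n)` per step and `O(B δ n ^ 2)` in total, that is, `O(B δ)` after normalisation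
(`abs_distWith_sub_le_of_affine`). Intensity parameters are handled by a Lipschitz bound.

A transformation has eight real parameters, bounded after scaling `t` by `1 / n` unless all pixels
leave the image and the distance is `1`. Hence a net of `O(1 / δ ^ 8)` transformations suffices
(`exists_transformation_net`). One common random sample of about `log(1 / δ) / ε ^ 2` pixels
estimates the distance for every member within `ε`, by a Chernoff bound and a union bound
(`exists_sampling_alg`); the least estimate is the output. If `δ * n < 1`, reading both images
completely is within budget; for large `δ` or `ε` the answer `0` is good enough. -/

namespace ImageMatching

/-! ### Non-adaptive algorithms -/

/-- The algorithm that asks a list of queries, stores the answers in two images, and outputs a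
function of the two resulting images. -/
noncomputable def QueryAlg.readAll {n : ℕ} (f : GrayImage n → GrayImage n → ℝ) :
    List (Bool × Pixel n) → GrayImage n → GrayImage n → QueryAlg n
  | [], N₁, N₂ => .output (f N₁ N₂)
  | (false, p) :: l, N₁, N₂ => .query false p fun a => readAll f l (Function.update N₁ p a) N₂
  | (true, p) :: l, N₁, N₂ => .query true p fun a => readAll f l N₁ (Function.update N₂ p a)

theorem QueryAlg.queriesAtMost_readAll {n : ℕ} (f : GrayImage n → GrayImage n → ℝ)
    (l : List (Bool × Pixel n)) (N₁ N₂ : GrayImage n) :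
    (readAll f l N₁ N₂).QueriesAtMost l.length := by
  induction l generalizing N₁ N₂ with
  | nil => trivial
  | cons a l ih =>
    obtain ⟨b, p⟩ := a
    cases b
    · exact fun a => ih _ _
    · exact fun a => ih _ _

/-- The disjunctions are the induction invariant: a position ends up correct if it is still to be
read or already holds the right value. -/
theorem QueryAlg.run_readAll {n : ℕ} (f : GrayImage n → GrayImage n → ℝ) (M₁ M₂ : GrayImage n)
    (l : List (Bool × Pixel n)) (N₁ N₂ : GrayImage n) :
    ∃ N₁' N₂' : GrayImage n, (readAll f l N₁ N₂).run M₁ M₂ = PMF.pure (f N₁' N₂') ∧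
      (∀ p, ((false, p) ∈ l ∨ N₁ p = M₁ p) → N₁' p = M₁ p) ∧
      (∀ p, ((true, p) ∈ l ∨ N₂ p = M₂ p) → N₂' p = M₂ p) := by
  induction l generalizing N₁ N₂ with
  | nil => exact ⟨N₁, N₂, rfl, by simp, by simp⟩
  | cons a l ih =>
    obtain ⟨b, p⟩ := a
    cases b
    · obtain ⟨N₁', N₂', h, h₁, h₂⟩ := ih (Function.update N₁ p (M₁ p)) N₂
      refine ⟨N₁', N₂', h, fun q hq => h₁ q ?_, fun q hq => h₂ q ?_⟩
      · by_cases hqp : q = p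
        · subst hqp; simp
        · simpa [hqp] using hq
      · simpa using hq
    · obtain ⟨N₁', N₂', h, h₁, h₂⟩ := ih N₁ (Function.update N₂ p (M₂ p))
      refine ⟨N₁', N₂', h, fun q hq => h₁ q ?_, fun q hq => h₂ q ?_⟩
      · simpa using hq
      · by_cases hqp : q = p
        · subst hqp; simp
        · simpa [hqp] using hq

/-- A function of two images that only depends on the values at the positions in a list is computed
with one query for each member of the list. -/
theorem QueryAlg.exists_run_eq_pure {n : ℕ} (f : GrayImage n → GrayImage n → ℝ)
    (l : List (Bool × Pixel n))
    (hf : ∀ M₁ M₂ N₁ N₂ : GrayImage n, (∀ p, (false, p) ∈ l → N₁ p = M₁ p) →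
      (∀ p, (true, p) ∈ l → N₂ p = M₂ p) → f N₁ N₂ = f M₁ M₂) :
    ∃ alg : QueryAlg n, alg.QueriesAtMost l.length ∧
      ∀ M₁ M₂, alg.run M₁ M₂ = PMF.pure (f M₁ M₂) := by
  -- The zero images are placeholders: by `hf` the values at unread positions do not matter.
  refine ⟨readAll f l (fun _ => 0) fun _ => 0, queriesAtMost_readAll f l _ _, fun M₁ M₂ => ?_⟩
  obtain ⟨N₁, N₂, h, h₁, h₂⟩ := run_readAll f M₁ M₂ l (fun _ => 0) fun _ => 0
  rw [h, hf M₁ M₂ N₁ N₂ (fun p hp => h₁ p (Or.inl hp)) fun p hp => h₂ p (Or.inl hp)]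

open Classical in
/-- Drawing a uniformly random element of a finite type first. -/
theorem QueryAlg.exists_random {n : ℕ} {Ω : Type*} [Fintype Ω] [Nonempty Ω] (q : ℕ)
    (f : Ω → GrayImage n → GrayImage n → ℝ)
    (h : ∀ ω, ∃ alg : QueryAlg n, alg.QueriesAtMost q ∧
      ∀ M₁ M₂, alg.run M₁ M₂ = PMF.pure (f ω M₁ M₂)) :
    ∃ alg : QueryAlg n, alg.QueriesAtMost q ∧
      ∀ M₁ M₂ (E : Set ℝ), MeasurableSet E → (alg.run M₁ M₂).toMeasure.real E =
        (Finset.univ.filter fun ω => f ω M₁ M₂ ∈ E).card / Fintype.card Ω := by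
  choose alg hq hrun using h
  have hcard : Fintype.card Ω = Fintype.card Ω - 1 + 1 :=
    (Nat.sub_add_cancel Fintype.card_pos).symm
  let e : Ω ≃ Fin (Fintype.card Ω - 1 + 1) := Fintype.equivFinOfCardEq hcard
  refine ⟨.random (Fintype.card Ω - 1) fun i => alg (e.symm i), ?_, fun M₁ M₂ E hE => ?_⟩
  · cases q
    · exact fun i => hq _
    · exact fun i => hq _
  · have hr : (QueryAlg.random (Fintype.card Ω - 1) fun i => alg (e.symm i)).run M₁ M₂ =
        (PMF.uniformOfFintype (Fin (Fintype.card Ω - 1 + 1))).map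
          fun i => f (e.symm i) M₁ M₂ := by
      rw [← PMF.bind_pure_comp]
      simp only [QueryAlg.run, hrun]
      rfl
    rw [hr, MeasureTheory.measureReal_def, PMF.toMeasure_map_apply _ _ _ (measurable_of_countable _) hE,
      PMF.toMeasure_uniformOfFintype_apply _ (MeasurableSet.of_discrete), ENNReal.toReal_div]
    simp only [Fintype.card_fin, ENNReal.toReal_natCast]
    refine congrArg₂ (· / ·) (congrArg _ ?_) (congrArg _ hcard.symm)
    rw [Fintype.card_subtype]
    exact Finset.card_bij (fun i _ => e.symm i) (by simp) (by simp)
      fun ω hω => ⟨e ω, by simpa using hω, by simp⟩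

/-! ### Concentration of sample means -/

open Classical in
/-- A one-sided tail bound for sums of independent uniform samples of a centered function. -/
theorem card_sample_sum_ge_le {α : Type*} [Fintype α] (h : α → ℝ) (h_abs : ∀ a, |h a| ≤ 1)
    (h_sum : ∑ a, h a = 0) (S : ℕ) {ε : ℝ} (hε : 0 < ε) (hε1 : ε ≤ 1) :
    ((Finset.univ.filter fun s : Fin S → α => ε * S ≤ ∑ i, h (s i)).card : ℝ) ≤
      (Fintype.card α : ℝ) ^ S * Real.exp (-(ε ^ 2 * S / 4)) := by
  have hone : ∑ a, Real.exp (ε / 2 * h a) ≤ Fintype.card α * Real.exp (ε ^ 2 / 4) := by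
    -- The parameter `s = ε / 2` minimises the resulting exponent `s ^ 2 - ε * s`. The bound is `exp
    -- x ≤ 1 + x + x ^ 2` for `|x| ≤ 1`; its linear term sums to zero because `h` is centered.
    have hle : ∀ a, Real.exp (ε / 2 * h a) ≤ 1 + ε / 2 * h a + ε ^ 2 / 4 := fun a => by
      have ha : |ε / 2 * h a| ≤ ε / 2 := by
        rw [abs_mul, abs_of_pos (half_pos hε)]
        exact mul_le_of_le_one_right (half_pos hε).le (h_abs a)
      have h1 := (abs_le.1 (Real.abs_exp_sub_one_sub_id_le (ha.trans (by linarith)))).2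
      have h2 : (ε / 2 * h a) ^ 2 ≤ (ε / 2) ^ 2 := sq_le_sq' (abs_le.1 ha).1 (abs_le.1 ha).2
      nlinarith
    calc ∑ a, Real.exp (ε / 2 * h a) ≤ ∑ a, (1 + ε / 2 * h a + ε ^ 2 / 4) :=
          Finset.sum_le_sum fun a _ => hle a
      _ = Fintype.card α * (ε ^ 2 / 4 + 1) := by
          simp [Finset.sum_add_distrib, ← Finset.mul_sum, h_sum]; ring
      _ ≤ _ := by gcongr; exact Real.add_one_le_exp _
  -- Markov's inequality for the exponential of the sum. Expanding the `S`-th power over all tuples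
  -- plays the role of independence.
  have hmarkov : ((Finset.univ.filter fun s : Fin S → α => ε * S ≤ ∑ i, h (s i)).card : ℝ) *
      Real.exp (ε / 2 * (ε * S)) ≤ (∑ a, Real.exp (ε / 2 * h a)) ^ S := by
    rw [Fintype.sum_pow, ← nsmul_eq_mul]
    refine (Finset.card_nsmul_le_sum _ (fun s => ∏ i, Real.exp (ε / 2 * h (s i))) _ ?_).trans
      (Finset.sum_le_sum_of_subset_of_nonneg (Finset.filter_subset _ _) fun s _ _ => by positivity)
    intro s hs
    rw [← Real.exp_sum, ← Finset.mul_sum]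
    have := (Finset.mem_filter.1 hs).2
    gcongr
  rw [← mul_le_mul_iff_left₀ (Real.exp_pos (ε / 2 * (ε * S)))]
  refine hmarkov.trans ((pow_le_pow_left₀ (by positivity) hone S).trans_eq ?_)
  rw [mul_pow, ← Real.exp_nat_mul, mul_assoc, ← Real.exp_add]
  congr 2
  ring

open Classical in
/-- Sample means of a function with values in `[0, 1]` are concentrated around the mean. -/
theorem card_sample_mean_deviation_le {α : Type*} [Fintype α] [Nonempty α] (g : α → ℝ)
    (hg : ∀ a, g a ∈ Set.Icc (0 : ℝ) 1) {S : ℕ} (hS : 0 < S) {ε : ℝ} (hε : 0 < ε) (hε1 : ε ≤ 1) :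
    ((Finset.univ.filter fun s : Fin S → α =>
      ¬ |(∑ i, g (s i)) / S - (∑ a, g a) / Fintype.card α| ≤ ε).card : ℝ) ≤
      (Fintype.card α : ℝ) ^ S * (2 * Real.exp (-(ε ^ 2 * S / 4))) := by
  set m := (∑ a, g a) / Fintype.card α with hm
  have hc : (0 : ℝ) < Fintype.card α := by exact_mod_cast Fintype.card_pos
  have hS' : (0 : ℝ) < S := by exact_mod_cast hS
  have hm0 : 0 ≤ m := div_nonneg (Finset.sum_nonneg fun a _ => (hg a).1) hc.le
  have hm1 : m ≤ 1 := by
    rw [hm, div_le_one hc]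
    calc ∑ a, g a ≤ ∑ _a : α, (1 : ℝ) := Finset.sum_le_sum fun a _ => (hg a).2
      _ = _ := by simp
  have hsum : ∑ a, (g a - m) = 0 := by
    rw [Finset.sum_sub_distrib]; simp [hm]; field_simp; simp
  have habs : ∀ a, |g a - m| ≤ 1 := fun a =>
    abs_le.2 ⟨by linarith [(hg a).1], by linarith [(hg a).2]⟩
  have h1 := card_sample_sum_ge_le (fun a => g a - m) habs hsum S hε hε1
  have h2 := card_sample_sum_ge_le (fun a => -(g a - m)) (fun a => by rw [abs_neg]; exact habs a)
    (by rw [Finset.sum_neg_distrib, hsum, neg_zero]) S hε hε1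
  rw [two_mul, mul_add]
  refine le_trans ?_ (add_le_add h1 h2)
  rw [← Nat.cast_add]
  refine Nat.cast_le.2 (le_trans (Finset.card_le_card ?_) (Finset.card_union_le _ _))
  intro s hs
  simp only [Finset.mem_filter, Finset.mem_univ, true_and, Finset.mem_union,
    Finset.sum_neg_distrib, Finset.sum_sub_distrib, Finset.sum_const, Finset.card_univ,
    Fintype.card_fin, nsmul_eq_mul] at hs ⊢
  rw [not_le, lt_abs] at hs
  have key : (∑ i, g (s i)) = (∑ i, g (s i)) / S * S := by field_simp
  rcases hs with hs | hs
  · left; rw [key]; nlinarith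
  · right; rw [key]; nlinarith

end ImageMatching
namespace ImageMatching

/-! ### The cost of a single pixel -/

/-- The cost of a pixel of value `v` that is mapped to the integer point `q`. -/
noncomputable def costAt {κ : ℝ} {n : ℕ} (L : Intensity κ) (v : ℝ) (M : GrayImage n)
    (q : ℤ × ℤ) : ℝ :=
  if h : q ∈ pixels n then |v - L.apply (M ⟨q, h⟩ : ℝ)| else 1

open Classical in
/-- The contribution of a pixel to the perimeter size, extended by `0` to all integer points. -/
noncomputable def extGradient {n : ℕ} (M : GrayImage n) (q : ℤ × ℤ) : ℝ :=
  if h : q ∈ pixels n then (if IsOutermost ⟨q, h⟩ then 1 else gradient M ⟨q, h⟩) else 0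

theorem mem_pixels {n : ℕ} {q : ℤ × ℤ} :
    q ∈ pixels n ↔ (1 ≤ q.1 ∧ q.1 ≤ n) ∧ 1 ≤ q.2 ∧ q.2 ≤ n := by
  simp [pixels]

theorem card_pixel (n : ℕ) : Fintype.card (Pixel n) = n ^ 2 := by
  simp [pixels, sq]

theorem Intensity.apply_mem {κ : ℝ} (L : Intensity κ) (v : ℝ) :
    L.apply v ∈ Set.Icc (0 : ℝ) 1 :=
  ⟨le_max_left _ _, max_le zero_le_one (min_le_left _ _)⟩

theorem Intensity.abs_apply_sub_apply_le {κ : ℝ} (L L' : Intensity κ) (v w : ℝ) :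
    |L.apply v - L'.apply w| ≤ |(L.con * v + L.bri) - (L'.con * w + L'.bri)| := by
  refine (abs_max_sub_max_le_max _ _ _ _).trans ?_
  rw [sub_self, abs_zero, max_eq_right (abs_nonneg _)]
  refine (abs_min_sub_min_le_max _ _ _ _).trans ?_
  rw [sub_self, abs_zero, max_eq_right (abs_nonneg _)]

theorem costAt_mem {κ : ℝ} {n : ℕ} (L : Intensity κ) {v : ℝ} (hv : v ∈ Set.Icc (0 : ℝ) 1)
    (M : GrayImage n) (q : ℤ × ℤ) : costAt L v M q ∈ Set.Icc (0 : ℝ) 1 := by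
  unfold costAt
  split_ifs with h
  · have := L.apply_mem (M ⟨q, h⟩ : ℝ)
    exact ⟨abs_nonneg _, abs_le.2 ⟨by linarith [hv.1, this.2], by linarith [hv.2, this.1]⟩⟩
  · simp

theorem gradient_nonneg {n : ℕ} (M : GrayImage n) (p : Pixel n) : 0 ≤ gradient M p :=
  Real.iSup_nonneg fun _ => abs_nonneg _

theorem extGradient_nonneg {n : ℕ} (M : GrayImage n) (q : ℤ × ℤ) : 0 ≤ extGradient M q := by
  unfold extGradient
  split_ifs
  · exact zero_le_one
  · exact gradient_nonneg _ _
  · exact le_rfl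

theorem sum_extGradient {n : ℕ} (M : GrayImage n) :
    ∑ p : Pixel n, extGradient M p.1 = perimeterSize M :=
  Finset.sum_congr rfl fun p _ => by simp [extGradient]

theorem perimeterSize_nonneg {n : ℕ} (M : GrayImage n) : 0 ≤ perimeterSize M := by
  rw [← sum_extGradient]
  exact Finset.sum_nonneg fun p _ => extGradient_nonneg _ _

theorem abs_sub_le_gradient {n : ℕ} (M : GrayImage n) {p q : Pixel n} (h : Adjacent p q) :
    |(M p : ℝ) - M q| ≤ gradient M p :=
  le_ciSup (f := fun q : {q : Pixel n // Adjacent p q} => |(M p : ℝ) - (M q.1 : ℝ)|)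
    (Set.finite_range _).bddAbove ⟨q, h⟩

/-- Inside the image this is the `κ`-Lipschitz property of `L`. If `q` is outermost, or exactly one
of the points lies in the image (and is then outermost), the gradients sum to at least `1`, which
exceeds any difference of costs. Counting outermost pixels as `1` thus pays for leaving the image.
-/
theorem abs_costAt_sub_costAt_le {κ : ℝ} (hκ : 1 ≤ κ) {n : ℕ} (L : Intensity κ) {v : ℝ}
    (hv : v ∈ Set.Icc (0 : ℝ) 1) (M : GrayImage n) {q r : ℤ × ℤ} (h1 : |q.1 - r.1| ≤ 1)
    (h2 : |q.2 - r.2| ≤ 1) :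
    |costAt L v M q - costAt L v M r| ≤ κ * (extGradient M q + extGradient M r) := by
  have hq := costAt_mem L hv M q
  have hr := costAt_mem L hv M r
  have hq' := extGradient_nonneg M q
  have hr' := extGradient_nonneg M r
  have hle : |costAt L v M q - costAt L v M r| ≤ 1 :=
    abs_le.2 ⟨by linarith [hq.1, hr.2], by linarith [hq.2, hr.1]⟩
  have hbig : 1 ≤ extGradient M q + extGradient M r →
      |costAt L v M q - costAt L v M r| ≤ κ * (extGradient M q + extGradient M r) :=
    fun h => hle.trans (one_le_mul_of_one_le_of_one_le hκ h)
  have hout : ∀ q, ∀ h : q ∈ pixels n, IsOutermost (⟨q, h⟩ : Pixel n) → extGradient M q = 1 :=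
    fun q h ho => by simp [extGradient, h, ho]
  rw [abs_le] at h1 h2
  by_cases hqn : q ∈ pixels n <;> by_cases hrn : r ∈ pixels n
  · by_cases hqo : IsOutermost (⟨q, hqn⟩ : Pixel n)
    · exact hbig (by linarith [hout q hqn hqo])
    · have hqr : |(M ⟨q, hqn⟩ : ℝ) - M ⟨r, hrn⟩| ≤ extGradient M q := by
        have hg : extGradient M q = gradient M ⟨q, hqn⟩ := by simp [extGradient, hqn, hqo]
        rw [hg]
        by_cases hne : q = r
        · subst hne; simpa using gradient_nonneg M _
        · exact abs_sub_le_gradient M ⟨fun h => hne (congrArg Subtype.val h),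
            abs_le.2 h1, abs_le.2 h2⟩
      have hL := L.abs_apply_sub_apply_le L (M ⟨r, hrn⟩) (M ⟨q, hqn⟩)
      have hκ' : |L.con| ≤ κ := abs_le.2
        ⟨by have := L.con_mem.1; have : 0 ≤ 1 / κ := by positivity
            linarith, L.con_mem.2⟩
      simp only [costAt, hqn, hrn, dif_pos]
      refine (abs_abs_sub_abs_le _ _).trans ?_
      rw [sub_sub_sub_cancel_left]
      refine hL.trans ?_
      rw [add_sub_add_right_eq_sub, ← mul_sub, abs_mul, abs_sub_comm]
      exact mul_le_mul hκ' (by linarith) (abs_nonneg _) (by linarith)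
  · refine hbig ?_
    rw [hout q hqn ?_]
    · linarith
    · rw [mem_pixels] at hqn hrn
      simp only [IsOutermost]
      omega
  · refine hbig ?_
    rw [hout r hrn ?_]
    · linarith
    · rw [mem_pixels] at hqn hrn
      simp only [IsOutermost]
      omega
  · simp only [costAt, hqn, hrn, dif_neg, not_false_eq_true, sub_self, abs_zero]
    positivity

open Classical in
/-- A map that is at most `D`-to-one increases the perimeter size at most `D`-fold. -/
theorem sum_extGradient_comp_le {n : ℕ} (M : GrayImage n) (f : Pixel n → ℤ × ℤ) {D : ℝ}
    (hD : ∀ q, ((Finset.univ.filter fun p => f p = q).card : ℝ) ≤ D) :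
    ∑ p, extGradient M (f p) ≤ D * perimeterSize M := by
  have h : ∀ p, extGradient M (f p) =
      ∑ q : Pixel n, if f p = q.1 then extGradient M q.1 else 0 := fun p => by
    by_cases hp : f p ∈ pixels n
    · rw [Finset.sum_eq_single (⟨f p, hp⟩ : Pixel n)]
      · simp
      · rintro ⟨b, hb⟩ - hne
        exact if_neg fun h => hne (Subtype.ext h.symm)
      · simp
    · rw [Finset.sum_eq_zero]
      · simp [extGradient, hp]
      · rintro ⟨b, hb⟩ -
        exact if_neg fun h => hp (by rw [h]; exact hb)
  rw [← sum_extGradient, Finset.mul_sum, Finset.sum_congr rfl fun p _ => h p, Finset.sum_comm]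
  refine Finset.sum_le_sum fun q _ => ?_
  rw [← Finset.sum_filter, Finset.sum_const, nsmul_eq_mul]
  exact mul_le_mul_of_nonneg_right (hD _) (extGradient_nonneg _ _)

/-! ### Affine maps -/

/-- The coordinates of `A p + t`. -/
def affineCoord (A : Matrix (Fin 2) (Fin 2) ℝ) (t : Fin 2 → ℝ) (p : ℤ × ℤ) (i : Fin 2) : ℝ :=
  A i 0 * p.1 + A i 1 * p.2 + t i

/-- The map `p ↦ ⌊A p + t⌋`. -/
noncomputable def floorAffine (A : Matrix (Fin 2) (Fin 2) ℝ) (t : Fin 2 → ℝ) (p : ℤ × ℤ) :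
    ℤ × ℤ :=
  (⌊affineCoord A t p 0⌋, ⌊affineCoord A t p 1⌋)

theorem ImageAffine.apply_eq {c : ℝ} (T : ImageAffine c) (p : ℤ × ℤ) :
    T.apply p = floorAffine T.A T.t p := by
  simp [ImageAffine.apply, floorAffine, affineCoord, Matrix.mulVec, dotProduct, Fin.sum_univ_two]

theorem norm_sq_toEuclideanLin (A : Matrix (Fin 2) (Fin 2) ℝ) (x y : ℝ) :
    ‖Matrix.toEuclideanLin A !₂[x, y]‖ ^ 2 =
      (A 0 0 * x + A 0 1 * y) ^ 2 + (A 1 0 * x + A 1 1 * y) ^ 2 := by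
  simp [EuclideanSpace.norm_sq_eq, Fin.sum_univ_two, Matrix.toEuclideanLin]

theorem norm_sq_vec (x y : ℝ) : ‖(!₂[x, y] : EuclideanSpace ℝ (Fin 2))‖ ^ 2 = x ^ 2 + y ^ 2 := by
  simp [EuclideanSpace.norm_sq_eq, Fin.sum_univ_two]

/-- The lower scaling bound gives `x ^ 2 + y ^ 2 ≤ 2 * c ^ 2 * r ^ 2`; the factor `√2` is rounded up
to `2`. -/
theorem ImageAffine.abs_le {c : ℝ} (hc : 1 ≤ c) (T : ImageAffine c) {x y r : ℝ} (hr : 0 ≤ r)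
    (h0 : |T.A 0 0 * x + T.A 0 1 * y| ≤ r) (h1 : |T.A 1 0 * x + T.A 1 1 * y| ≤ r) :
    max |x| |y| ≤ 2 * c * r := by
  have h := (T.scaling !₂[x, y]).1
  rw [div_le_iff₀ (by linarith)] at h
  have h2 := pow_le_pow_left₀ (norm_nonneg _) h 2
  rw [mul_pow, norm_sq_toEuclideanLin, norm_sq_vec] at h2
  have h0' := sq_le_sq' (_root_.abs_le.1 h0).1 (_root_.abs_le.1 h0).2
  have h1' := sq_le_sq' (_root_.abs_le.1 h1).1 (_root_.abs_le.1 h1).2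
  have h3 : x ^ 2 + y ^ 2 ≤ (2 * c * r) ^ 2 := by
    refine h2.trans ?_
    have : 0 ≤ c ^ 2 := sq_nonneg c
    nlinarith [mul_nonneg this (sq_nonneg r)]
  have hcr : 0 ≤ 2 * c * r := by positivity
  exact max_le (abs_le_of_sq_le_sq (by nlinarith [sq_nonneg y]) hcr)
    (abs_le_of_sq_le_sq (by nlinarith [sq_nonneg x]) hcr)

theorem ImageAffine.abs_entry_le {c : ℝ} (hc : 1 ≤ c) (T : ImageAffine c) (i j : Fin 2) :
    |T.A i j| ≤ c := by
  have hc0 : 0 ≤ c := by linarith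
  have key : ∀ x y : ℝ, x ^ 2 + y ^ 2 = 1 →
      (T.A 0 0 * x + T.A 0 1 * y) ^ 2 + (T.A 1 0 * x + T.A 1 1 * y) ^ 2 ≤ c ^ 2 := fun x y hxy => by
    have h2 := pow_le_pow_left₀ (norm_nonneg _) (T.scaling !₂[x, y]).2 2
    rwa [mul_pow, norm_sq_toEuclideanLin, norm_sq_vec, hxy, mul_one] at h2
  have k0 := key 1 0 (by norm_num)
  have k1 := key 0 1 (by norm_num)
  simp only [mul_one, mul_zero, add_zero, zero_add] at k0 k1
  refine abs_le_of_sq_le_sq ?_ hc0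
  fin_cases i <;> fin_cases j <;> simp
  · nlinarith [sq_nonneg (T.A 1 0)]
  · nlinarith [sq_nonneg (T.A 1 1)]
  · nlinarith [sq_nonneg (T.A 0 0)]
  · nlinarith [sq_nonneg (T.A 0 1)]

/-- Lower bounds for matrices near the matrix of an image-affine transformation. -/
theorem ImageAffine.abs_le_of_near {c : ℝ} (hc : 1 ≤ c) (T : ImageAffine c) {δ : ℝ} (hδ : 0 ≤ δ)
    (hδc : 8 * c * δ ≤ 1) {A : Matrix (Fin 2) (Fin 2) ℝ} (hA : ∀ i j, |A i j - T.A i j| ≤ δ)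
    {x y r : ℝ} (hr : 0 ≤ r) (h0 : |A 0 0 * x + A 0 1 * y| ≤ r)
    (h1 : |A 1 0 * x + A 1 1 * y| ≤ r) : max |x| |y| ≤ 4 * c * r := by
  set z := max |x| |y| with hz
  have hx : |x| ≤ z := le_max_left _ _
  have hy : |y| ≤ z := le_max_right _ _
  have hz0 : 0 ≤ z := (abs_nonneg x).trans hx
  have key : ∀ i, |A i 0 * x + A i 1 * y| ≤ r → |T.A i 0 * x + T.A i 1 * y| ≤ r + 2 * δ * z := by
    intro i hi
    have e0 : |(A i 0 - T.A i 0) * x| ≤ δ * z := by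
      rw [abs_mul]; exact mul_le_mul (hA i 0) hx (abs_nonneg _) hδ
    have e1 : |(A i 1 - T.A i 1) * y| ≤ δ * z := by
      rw [abs_mul]; exact mul_le_mul (hA i 1) hy (abs_nonneg _) hδ
    rw [_root_.abs_le] at *
    constructor <;> nlinarith
  have h := T.abs_le hc (by positivity) (key 0 h0) (key 1 h1)
  rw [← hz] at h
  -- Here `z ≤ 2 * c * (r + 2 * δ * z) ≤ 2 * c * r + z / 2`, and the last term is absorbed on the
  -- left.
  nlinarith [mul_le_mul_of_nonneg_right hδc hz0]

open Classical in
/-- Rounded affine maps with a matrix near that of an image-affine transformation have small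
fibers. -/
theorem ImageAffine.card_fiber_le {c : ℝ} (hc : 1 ≤ c) (T : ImageAffine c) {δ : ℝ} (hδ : 0 ≤ δ)
    (hδc : 8 * c * δ ≤ 1) {A : Matrix (Fin 2) (Fin 2) ℝ} (hA : ∀ i j, |A i j - T.A i j| ≤ δ)
    (t : Fin 2 → ℝ) {n : ℕ} (q : ℤ × ℤ) :
    ((Finset.univ.filter fun p : Pixel n => floorAffine A t p.1 = q).card : ℝ) ≤
      (8 * c + 1) ^ 2 := by
  rcases (Finset.univ.filter fun p : Pixel n => floorAffine A t p.1 = q).eq_empty_or_nonempty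
    with he | ⟨p₀, hp₀⟩
  · rw [he]; simp; positivity
  -- Two points of one fiber have images less than `1` apart in each coordinate, so they differ by
  -- at most `4 * c` in each coordinate. The fiber lies in a box of side `2 * m + 1 ≤ 8 * c + 1`.
  set m : ℕ := ⌊4 * c⌋₊ with hm
  have hmc : (m : ℝ) ≤ 4 * c := Nat.floor_le (by linarith)
  replace hp₀ : floorAffine A t p₀.1 = q := (Finset.mem_filter.1 hp₀).2
  have hbox : ∀ p : Pixel n, floorAffine A t p.1 = q →
      p.1 ∈ Finset.Icc (p₀.1.1 - m) (p₀.1.1 + m) ×ˢ Finset.Icc (p₀.1.2 - m) (p₀.1.2 + m) := by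
    intro p hp
    have hd : floorAffine A t p.1 = floorAffine A t p₀.1 := hp.trans hp₀.symm
    have e0 := Int.abs_sub_lt_one_of_floor_eq_floor (congrArg Prod.fst hd)
    have e1 := Int.abs_sub_lt_one_of_floor_eq_floor (congrArg Prod.snd hd)
    have e (i : Fin 2) : affineCoord A t p.1 i - affineCoord A t p₀.1 i =
        A i 0 * ((p.1.1 - p₀.1.1 : ℤ) : ℝ) + A i 1 * ((p.1.2 - p₀.1.2 : ℤ) : ℝ) := by
      simp only [affineCoord]; push_cast; ring
    rw [e] at e0 e1
    have h := T.abs_le_of_near hc hδ hδc hA zero_le_one e0.le e1.le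
    rw [mul_one, max_le_iff, ← Int.cast_abs, ← Int.cast_abs] at h
    have hfl : ∀ k : ℤ, ((|k| : ℤ) : ℝ) ≤ 4 * c → |k| ≤ m := fun k hk => by
      have : k.natAbs ≤ m := Nat.le_floor (by rwa [Nat.cast_natAbs])
      rw [Int.abs_eq_natAbs]
      exact_mod_cast this
    have h1 := _root_.abs_le.1 (hfl _ h.1)
    have h2 := _root_.abs_le.1 (hfl _ h.2)
    rw [Finset.mem_product, Finset.mem_Icc, Finset.mem_Icc]
    omega
  have hcard := Finset.card_le_card_of_injOn
    (s := Finset.univ.filter fun p : Pixel n => floorAffine A t p.1 = q) (fun p => p.1)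
    (fun p hp => hbox p (Finset.mem_filter.1 hp).2) Subtype.val_injective.injOn
  rw [Finset.card_product, Int.card_Icc, Int.card_Icc] at hcard
  have h1 : ∀ k : ℤ, (k + m + 1 - (k - m)).toNat = 2 * m + 1 := fun k => by omega
  rw [h1, h1] at hcard
  have h2 : (2 * m + 1 : ℝ) ≤ 8 * c + 1 := by linarith
  calc ((Finset.univ.filter fun p : Pixel n => floorAffine A t p.1 = q).card : ℝ)
      ≤ (2 * m + 1) * (2 * m + 1) := by exact_mod_cast hcard
    _ ≤ (8 * c + 1) ^ 2 := by
        rw [sq]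
        exact mul_le_mul h2 h2 (by positivity) (by linarith)

/-! ### Continuity of the distance in the transformation. -/

theorem abs_floor_sub_floor_le_one {x y : ℝ} (h : |x - y| ≤ 1) : |⌊x⌋ - ⌊y⌋| ≤ 1 := by
  rw [abs_le] at h ⊢
  have a := Int.floor_le x
  have b := Int.lt_floor_add_one x
  have a' := Int.floor_le y
  have b' := Int.lt_floor_add_one y
  constructor
  · have : (⌊y⌋ : ℝ) < ⌊x⌋ + 2 := by linarith
    have : ⌊y⌋ < ⌊x⌋ + 2 := by exact_mod_cast this
    omega
  · have : (⌊x⌋ : ℝ) < ⌊y⌋ + 2 := by linarith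
    have : ⌊x⌋ < ⌊y⌋ + 2 := by exact_mod_cast this
    omega

/-- Moving along a straight line from one affine map to another one in `m` steps. -/
theorem abs_costAt_floorAffine_sub_le {κ : ℝ} (hκ : 1 ≤ κ) {n : ℕ} (L : Intensity κ) {v : ℝ}
    (hv : v ∈ Set.Icc (0 : ℝ) 1) (M : GrayImage n) (A A' : Matrix (Fin 2) (Fin 2) ℝ)
    (t t' : Fin 2 → ℝ) (p : ℤ × ℤ) {m : ℕ} (hm : 0 < m)
    (h : ∀ i, |affineCoord A' t' p i - affineCoord A t p i| ≤ m) :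
    |costAt L v M (floorAffine A t p) - costAt L v M (floorAffine A' t' p)| ≤
      ∑ j ∈ Finset.range m, κ *
        (extGradient M (floorAffine (A + (j / m : ℝ) • (A' - A)) (t + (j / m : ℝ) • (t' - t)) p) +
        extGradient M (floorAffine (A + ((j + 1 : ℕ) / m : ℝ) • (A' - A))
          (t + ((j + 1 : ℕ) / m : ℝ) • (t' - t)) p)) := by
  have hm' : (0 : ℝ) < m := by exact_mod_cast hm
  let F : ℕ → ℤ × ℤ := fun j =>
    floorAffine (A + (j / m : ℝ) • (A' - A)) (t + (j / m : ℝ) • (t' - t)) p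
  have h0 : F 0 = floorAffine A t p := by simp [F]
  have h1 : F m = floorAffine A' t' p := by simp [F, div_self hm'.ne']
  rw [← h0, ← h1, ← Real.dist_eq]
  refine (dist_le_range_sum_dist (fun j => costAt L v M (F j)) m).trans
    (Finset.sum_le_sum fun j _ => ?_)
  rw [Real.dist_eq]
  have key : ∀ i, |affineCoord (A + (j / m : ℝ) • (A' - A)) (t + (j / m : ℝ) • (t' - t)) p i -
      affineCoord (A + ((j + 1 : ℕ) / m : ℝ) • (A' - A))
          (t + ((j + 1 : ℕ) / m : ℝ) • (t' - t)) p i| ≤ 1 := fun i => by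
    have e : affineCoord (A + (j / m : ℝ) • (A' - A)) (t + (j / m : ℝ) • (t' - t)) p i -
      affineCoord (A + ((j + 1 : ℕ) / m : ℝ) • (A' - A))
          (t + ((j + 1 : ℕ) / m : ℝ) • (t' - t)) p i =
        -((affineCoord A' t' p i - affineCoord A t p i) / m) := by
      simp only [affineCoord, Matrix.add_apply, Matrix.smul_apply, Matrix.sub_apply, Pi.add_apply,
        Pi.smul_apply, Pi.sub_apply, smul_eq_mul]
      push_cast
      field_simp
      ring
    rw [e, abs_neg, abs_div, abs_of_pos hm', div_le_one hm']
    exact h i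
  exact abs_costAt_sub_costAt_le hκ L hv M (abs_floor_sub_floor_le_one (key 0))
    (abs_floor_sub_floor_le_one (key 1))

theorem distWith_eq {c κ : ℝ} {n : ℕ} (T : ImageAffine c) (L : Intensity κ)
    (M₁ M₂ : GrayImage n) :
    distWith T L M₁ M₂ = 1 / (n : ℝ) ^ 2 * ∑ p : Pixel n, costAt L (M₁ p) M₂ (T.apply p.1) :=
  rfl

theorem distWith_mem {c κ : ℝ} {n : ℕ} (T : ImageAffine c) (L : Intensity κ)
    (M₁ M₂ : GrayImage n) : distWith T L M₁ M₂ ∈ Set.Icc (0 : ℝ) 1 := by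
  rw [distWith_eq]
  constructor
  · exact mul_nonneg (by positivity)
      (Finset.sum_nonneg fun p _ => (costAt_mem L (M₁ p).2 M₂ _).1)
  · rw [one_div_mul_eq_div]
    refine div_le_one_of_le₀ ?_ (by positivity)
    calc _ ≤ ∑ _p : Pixel n, (1 : ℝ) :=
          Finset.sum_le_sum fun p _ => (costAt_mem L (M₁ p).2 M₂ _).2
      _ = _ := by rw [Finset.sum_const, Finset.card_univ, card_pixel]; simp

/-- The distance depends continuously on the affine map, with a modulus given by the perimeter
size of the second image. -/
theorem abs_distWith_sub_le_of_affine {c κ : ℝ} (hc : 1 ≤ c) (hκ : 1 ≤ κ) {n : ℕ} (hn : 0 < n)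
    (T T' : ImageAffine c) (L : Intensity κ) (M₁ M₂ : GrayImage n) {δ B : ℝ} (hδ : 0 ≤ δ)
    (hδc : 8 * c * δ ≤ 1) (hδn : 1 ≤ δ * n) (hA : ∀ i j, |T'.A i j - T.A i j| ≤ δ)
    (ht : ∀ i, |T'.t i - T.t i| ≤ δ * n) (hB : perimeterSize M₂ ≤ B * n) :
    |distWith T L M₁ M₂ - distWith T' L M₁ M₂| ≤ 8 * κ * (8 * c + 1) ^ 2 * B * δ := by
  classical
  have hn' : (0 : ℝ) < n := by exact_mod_cast hn
  -- Two matrix entries and the translation each move a coordinate by at most `δ * n`. Since `1 ≤ δ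
  -- * n`, rounding up keeps `m ≤ 4 * δ * n`.
  set m : ℕ := ⌈3 * δ * n⌉₊ with hm_def
  have hm : 0 < m := Nat.ceil_pos.2 (by nlinarith)
  have hm' : (0 : ℝ) < m := by exact_mod_cast hm
  have hm3 : 3 * δ * n ≤ m := Nat.le_ceil _
  have hm4 : (m : ℝ) ≤ 4 * δ * n := by
    have := (Nat.ceil_lt_add_one (show 0 ≤ 3 * δ * n by positivity)).le
    rw [← hm_def] at this
    nlinarith
  set G : ℕ → Pixel n → ℝ := fun j p => extGradient M₂ (floorAffine
    (T.A + (j / m : ℝ) • (T'.A - T.A)) (T.t + (j / m : ℝ) • (T'.t - T.t)) p.1) with hG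
  have hstep : ∀ p : Pixel n, |costAt L (M₁ p) M₂ (T.apply p.1) -
      costAt L (M₁ p) M₂ (T'.apply p.1)| ≤
      ∑ j ∈ Finset.range m, κ * (G j p + G (j + 1) p) := fun p => by
    rw [T.apply_eq, T'.apply_eq]
    refine abs_costAt_floorAffine_sub_le hκ L (M₁ p).2 M₂ T.A T'.A T.t T'.t p.1 hm fun i => ?_
    refine le_trans ?_ hm3
    obtain ⟨⟨a1, a2⟩, b1, b2⟩ := mem_pixels.1 p.2
    have hx : |(p.1.1 : ℝ)| ≤ n := abs_le.2 ⟨by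
      have : (1 : ℝ) ≤ p.1.1 := by exact_mod_cast a1
      linarith, by exact_mod_cast a2⟩
    have hy : |(p.1.2 : ℝ)| ≤ n := abs_le.2 ⟨by
      have : (1 : ℝ) ≤ p.1.2 := by exact_mod_cast b1
      linarith, by exact_mod_cast b2⟩
    have e : affineCoord T'.A T'.t p.1 i - affineCoord T.A T.t p.1 i =
        (T'.A i 0 - T.A i 0) * p.1.1 + (T'.A i 1 - T.A i 1) * p.1.2 + (T'.t i - T.t i) := by
      simp only [affineCoord]; ring
    rw [e]
    refine (abs_add_three _ _ _).trans ?_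
    rw [abs_mul, abs_mul]
    have := mul_le_mul (hA i 0) hx (abs_nonneg _) hδ
    have := mul_le_mul (hA i 1) hy (abs_nonneg _) hδ
    linarith [ht i]
  -- An interpolated matrix may violate the scaling bounds, but it stays within `δ` of `T.A`, which
  -- is all that the fiber bound needs.
  have hsum : ∀ j ≤ m, ∑ p, G j p ≤ (8 * c + 1) ^ 2 * (B * n) := fun j hj => by
    refine (sum_extGradient_comp_le M₂ _ fun q => T.card_fiber_le hc hδ hδc (fun a b => ?_) _ q).trans
      (mul_le_mul_of_nonneg_left hB (by positivity))
    rw [Matrix.add_apply, add_sub_cancel_left, Matrix.smul_apply, Matrix.sub_apply, smul_eq_mul,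
      abs_mul, abs_of_nonneg (by positivity)]
    have : (j / m : ℝ) ≤ 1 := div_le_one_of_le₀ (by exact_mod_cast hj) hm'.le
    exact (mul_le_of_le_one_left (abs_nonneg _) this).trans (hA a b)
  have hBn : 0 ≤ B * n := (perimeterSize_nonneg M₂).trans hB
  rw [distWith_eq, distWith_eq, ← mul_sub, ← Finset.sum_sub_distrib, abs_mul,
    abs_of_nonneg (by positivity), one_div_mul_eq_div, div_le_iff₀ (by positivity)]
  calc _ ≤ ∑ p : Pixel n, ∑ j ∈ Finset.range m, κ * (G j p + G (j + 1) p) :=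
        (Finset.abs_sum_le_sum_abs _ _).trans (Finset.sum_le_sum fun p _ => hstep p)
    _ = ∑ j ∈ Finset.range m, κ * (∑ p, G j p + ∑ p, G (j + 1) p) := by
        rw [Finset.sum_comm]
        simp only [← Finset.mul_sum, Finset.sum_add_distrib]
    _ ≤ ∑ j ∈ Finset.range m, κ * ((8 * c + 1) ^ 2 * (B * n) + (8 * c + 1) ^ 2 * (B * n)) := by
        refine Finset.sum_le_sum fun j hj => ?_
        have hj := Finset.mem_range.1 hj
        exact mul_le_mul_of_nonneg_left (add_le_add (hsum j hj.le) (hsum (j + 1) hj)) (by linarith)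
    _ = m * (2 * κ * (8 * c + 1) ^ 2 * (B * n)) := by
        rw [Finset.sum_const, Finset.card_range, nsmul_eq_mul]; ring
    _ ≤ 4 * δ * n * (2 * κ * (8 * c + 1) ^ 2 * (B * n)) := by gcongr
    _ = _ := by ring

/-- Truncation is 1-Lipschitz and pixel values lie in `[0, 1]`, so contrast and brightness
contribute at most `δ` each. -/
theorem abs_distWith_sub_le_of_intensity {c κ : ℝ} {n : ℕ} (hn : 0 < n)
    (T : ImageAffine c) (L L' : Intensity κ) (M₁ M₂ : GrayImage n) {δ : ℝ} (hδ : 0 ≤ δ)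
    (h_con : |L.con - L'.con| ≤ δ) (h_bri : |L.bri - L'.bri| ≤ δ) :
    |distWith T L M₁ M₂ - distWith T L' M₁ M₂| ≤ 2 * δ := by
  have hn' : (0 : ℝ) < n := by exact_mod_cast hn
  rw [distWith_eq, distWith_eq, ← mul_sub, ← Finset.sum_sub_distrib, abs_mul,
    abs_of_nonneg (by positivity), one_div_mul_eq_div, div_le_iff₀ (by positivity)]
  calc _ ≤ ∑ _p : Pixel n, 2 * δ := by
        refine (Finset.abs_sum_le_sum_abs _ _).trans (Finset.sum_le_sum fun p _ => ?_)
        unfold costAt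
        split_ifs with h
        · refine (abs_abs_sub_abs_le _ _).trans ?_
          rw [sub_sub_sub_cancel_left, abs_sub_comm]
          refine (L.abs_apply_sub_apply_le L' _ _).trans ?_
          obtain ⟨h0, h1⟩ := (M₂ ⟨T.apply p.1, h⟩).2
          rw [add_sub_add_comm, ← sub_mul]
          refine (abs_add_le _ _).trans ?_
          rw [abs_mul, abs_of_nonneg h0]
          have := mul_le_mul h_con h1 h0 hδ
          linarith
        · rw [sub_self, abs_zero]; positivity
    _ = _ := by rw [Finset.sum_const, Finset.card_univ, card_pixel]; simp; ring

end ImageMatching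
namespace ImageMatching

/-! ### Finite nets -/

/-- A set with a bounded parametrization by `d` real numbers has a net with at most
`(2 * R / δ + 3) ^ d` members. -/
theorem exists_net {X : Type*} {d : ℕ} (s : Set X) (v : X → Fin d → ℝ) {R δ : ℝ} (hδ : 0 < δ)
    (hR : 0 ≤ R) (hv : ∀ x ∈ s, ∀ i, |v x i| ≤ R) :
    ∃ N : Finset X, (N.card : ℝ) ≤ (2 * R / δ + 3) ^ d ∧
      ∀ x ∈ s, ∃ y ∈ N, ∀ i, |v y i - v x i| ≤ δ := by
  classical
  set m : ℕ := ⌈R / δ⌉₊ with hm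
  have hmR : (m : ℝ) ≤ R / δ + 1 := (Nat.ceil_lt_add_one (by positivity)).le
  have hRm : R / δ ≤ m := Nat.le_ceil _
  let φ : X → Fin d → ℤ := fun x i => ⌊v x i / δ⌋
  let I : Finset (Fin d → ℤ) := Fintype.piFinset fun _ => Finset.Icc (-(m : ℤ)) m
  have hφ : ∀ x ∈ s, φ x ∈ I := fun x hx => Fintype.mem_piFinset.2 fun i => by
    have h := abs_le.1 (hv x hx i)
    refine Finset.mem_Icc.2 ⟨Int.le_floor.2 ?_, Int.floor_le_iff.2 ?_⟩
    · push_cast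
      rw [le_div_iff₀ hδ]
      rw [div_le_iff₀ hδ] at hRm
      linarith
    · push_cast
      rw [div_lt_iff₀ hδ]
      rw [div_le_iff₀ hδ] at hRm
      nlinarith
  -- One representative is taken from each occupied grid cell, since a grid point itself need not be
  -- the parameter vector of any `x`.
  let J := I.filter fun j => ∃ x ∈ s, φ x = j
  have hJ : ∀ j : J, ∃ x ∈ s, φ x = j.1 := fun j => (Finset.mem_filter.1 j.2).2
  choose r _ hr using hJ
  refine ⟨Finset.univ.image r, ?_, fun x hx => ?_⟩
  · have h1 : (Finset.univ.image r).card ≤ (2 * m + 1) ^ d := by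
      refine Finset.card_image_le.trans ?_
      rw [Finset.card_univ, Fintype.card_coe]
      refine (Finset.card_filter_le _ _).trans_eq ?_
      rw [Fintype.card_piFinset, Finset.prod_const, Int.card_Icc, Finset.card_univ,
        Fintype.card_fin]
      congr 1
      omega
    calc ((Finset.univ.image r).card : ℝ) ≤ (2 * m + 1) ^ d := by exact_mod_cast h1
      _ ≤ _ := by
        refine pow_le_pow_left₀ (by positivity) ?_ d
        rw [mul_div_assoc]
        linarith
  · have hxJ : φ x ∈ J := Finset.mem_filter.2 ⟨hφ x hx, x, hx, rfl⟩
    refine ⟨r ⟨φ x, hxJ⟩, Finset.mem_image_of_mem _ (Finset.mem_univ _), fun i => ?_⟩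
    have h := Int.abs_sub_lt_one_of_floor_eq_floor (congrFun (hr ⟨φ x, hxJ⟩) i)
    rw [← sub_div, abs_div, abs_of_pos hδ, div_lt_one hδ] at h
    exact h.le

/-- The translation part of a transformation that maps some pixel into the image is bounded. -/
theorem ImageAffine.abs_translation_le {c : ℝ} (hc : 1 ≤ c) (T : ImageAffine c) {n : ℕ}
    {p : ℤ × ℤ} (hp : p ∈ pixels n) (h : T.apply p ∈ pixels n) (i : Fin 2) :
    |T.t i| ≤ (2 + 2 * c) * n := by
  rw [mem_pixels] at hp
  rw [T.apply_eq, mem_pixels] at h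
  have hn : (1 : ℝ) ≤ n := by
    have : (1 : ℤ) ≤ n := hp.1.1.trans hp.1.2
    exact_mod_cast this
  have hz : ∀ z : ℤ, 1 ≤ z ∧ z ≤ n → |(z : ℝ)| ≤ n := fun z hz => by
    have h1 : (1 : ℝ) ≤ z := by exact_mod_cast hz.1
    have h2 : (z : ℝ) ≤ n := by exact_mod_cast hz.2
    exact _root_.abs_le.2 ⟨by linarith, h2⟩
  have hfl : |affineCoord T.A T.t p i| ≤ n + 1 := by
    have hi : 1 ≤ ⌊affineCoord T.A T.t p i⌋ ∧ ⌊affineCoord T.A T.t p i⌋ ≤ n := by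
      fin_cases i
      · exact h.1
      · exact h.2
    have h1 := Int.floor_le (affineCoord T.A T.t p i)
    have h2 := Int.lt_floor_add_one (affineCoord T.A T.t p i)
    have h3 : (1 : ℝ) ≤ ⌊affineCoord T.A T.t p i⌋ := by exact_mod_cast hi.1
    have h4 : (⌊affineCoord T.A T.t p i⌋ : ℝ) ≤ n := by exact_mod_cast hi.2
    exact _root_.abs_le.2 ⟨by linarith, by linarith⟩
  have e0 : |T.A i 0 * p.1| ≤ c * n := by
    rw [abs_mul]; exact mul_le_mul (T.abs_entry_le hc i 0) (hz _ hp.1) (abs_nonneg _) (by linarith)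
  have e1 : |T.A i 1 * p.2| ≤ c * n := by
    rw [abs_mul]; exact mul_le_mul (T.abs_entry_le hc i 1) (hz _ hp.2) (abs_nonneg _) (by linarith)
  simp only [affineCoord] at hfl
  rw [_root_.abs_le] at *
  constructor <;> nlinarith

/-- A net of transformations that is good for all images. -/
theorem exists_transformation_net {c κ : ℝ} (hc : 1 ≤ c) (hκ : 1 ≤ κ) {n : ℕ} (hn : 0 < n) {δ : ℝ}
    (hδ : 0 < δ) (hδc : 8 * c * δ ≤ 1) (hδn : 1 ≤ δ * n) :
    ∃ N : Finset (ImageAffine c × Intensity κ),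
      (N.card : ℝ) ≤ (2 * (2 + 2 * c + κ) / δ + 3) ^ 8 ∧
      ∀ (T : ImageAffine c) (L : Intensity κ) (B : ℝ) (M₁ M₂ : GrayImage n),
        perimeterSize M₂ ≤ B * n → distWith T L M₁ M₂ = 1 ∨
        ∃ x ∈ N, |distWith T L M₁ M₂ - distWith x.1 x.2 M₁ M₂| ≤
          (8 * κ * (8 * c + 1) ^ 2 * B + 2) * δ := by
  have hn' : (0 : ℝ) < n := by exact_mod_cast hn
  -- The exponent `8` counts four matrix entries, two translation coordinates and two intensity
  -- parameters. Dividing `t` by `n` makes its range independent of `n`.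
  obtain ⟨N, hcard, hN⟩ := exists_net
    {x : ImageAffine c × Intensity κ | ∃ p ∈ pixels n, x.1.apply p ∈ pixels n}
    (fun x => ![x.1.A 0 0, x.1.A 0 1, x.1.A 1 0, x.1.A 1 1, x.1.t 0 / n, x.1.t 1 / n,
      x.2.con, x.2.bri]) (R := 2 + 2 * c + κ) hδ (by linarith) (by
    rintro ⟨T, L⟩ ⟨p, hp, hT⟩ i
    have hA := fun i j => (T.abs_entry_le hc i j).trans (show c ≤ 2 + 2 * c + κ by linarith)
    have ht : ∀ i, |T.t i / n| ≤ 2 + 2 * c + κ := fun i => by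
      rw [abs_div, abs_of_pos hn', div_le_iff₀ hn']
      exact (T.abs_translation_le hc hp hT i).trans
        (mul_le_mul_of_nonneg_right (by linarith) hn'.le)
    have h_con : |L.con| ≤ 2 + 2 * c + κ := by
      have h1 := L.con_mem.1
      have h2 : 0 ≤ 1 / κ := by positivity
      exact abs_le.2 ⟨by linarith, by linarith [L.con_mem.2]⟩
    have h_bri : |L.bri| ≤ 2 + 2 * c + κ :=
      abs_le.2 ⟨by linarith [L.bri_mem.1], by linarith [L.bri_mem.2]⟩
    fin_cases i
    · exact hA 0 0
    · exact hA 0 1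
    · exact hA 1 0
    · exact hA 1 1
    · exact ht 0
    · exact ht 1
    · exact h_con
    · exact h_bri)
  refine ⟨N, hcard, fun T L B M₁ M₂ hB => ?_⟩
  by_cases hT : ∃ p ∈ pixels n, T.apply p ∈ pixels n
  · right
    obtain ⟨⟨T', L'⟩, hx, h⟩ := hN (T, L) hT
    refine ⟨(T', L'), hx, ?_⟩
    have hA : ∀ i j, |T'.A i j - T.A i j| ≤ δ := fun i j => by
      fin_cases i <;> fin_cases j
      · exact h 0
      · exact h 1
      · exact h 2
      · exact h 3
    have ht : ∀ i, |T'.t i - T.t i| ≤ δ * n := fun i => by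
      have : |T'.t i / n - T.t i / n| ≤ δ := by
        fin_cases i
        · exact h 4
        · exact h 5
      rwa [← sub_div, abs_div, abs_of_pos hn', div_le_iff₀ hn'] at this
    have h1 := abs_distWith_sub_le_of_affine hc hκ hn T T' L M₁ M₂ hδ.le hδc hδn hA ht hB
    have h2 := abs_distWith_sub_le_of_intensity hn T' L L' M₁ M₂ hδ.le
      (by rw [abs_sub_comm]; exact h 6) (by rw [abs_sub_comm]; exact h 7)
    have h3 := abs_sub_le (distWith T L M₁ M₂) (distWith T' L M₁ M₂) (distWith T' L' M₁ M₂)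
    simp only
    linarith
  · left
    push Not at hT
    rw [distWith_eq, Finset.sum_congr rfl fun p _ => by rw [costAt, dif_neg (hT p.1 p.2)],
      Finset.sum_const, Finset.card_univ, card_pixel]
    simp [hn.ne']

/-! ### From the net to the minimum over all transformations. -/

theorem imageDist_le {c κ : ℝ} {n : ℕ} (T : ImageAffine c) (L : Intensity κ)
    (M₁ M₂ : GrayImage n) : imageDist c κ M₁ M₂ ≤ distWith T L M₁ M₂ :=
  ciInf_le (f := fun TL : ImageAffine c × Intensity κ => distWith TL.1 TL.2 M₁ M₂)
    ⟨0, by rintro _ ⟨x, rfl⟩; exact (distWith_mem _ _ _ _).1⟩ (T, L)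

theorem nonempty_imageAffine {c : ℝ} (hc : 1 ≤ c) : Nonempty (ImageAffine c) :=
  ⟨⟨1, 0, fun v => by
    have h : Matrix.toEuclideanLin (1 : Matrix (Fin 2) (Fin 2) ℝ) v = v := by
      simp [Matrix.toEuclideanLin]
    rw [h]
    exact ⟨div_le_self (norm_nonneg v) hc, le_mul_of_one_le_left (norm_nonneg v) hc⟩⟩⟩

theorem nonempty_intensity {κ : ℝ} (hκ : 1 ≤ κ) : Nonempty (Intensity κ) :=
  ⟨⟨1, 0, ⟨div_le_one_of_le₀ hκ (by linarith), hκ⟩, ⟨by linarith, zero_le_one⟩⟩⟩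

theorem imageDist_mem {c κ : ℝ} (hc : 1 ≤ c) (hκ : 1 ≤ κ) {n : ℕ} (M₁ M₂ : GrayImage n) :
    imageDist c κ M₁ M₂ ∈ Set.Icc (0 : ℝ) 1 := by
  obtain ⟨T⟩ := nonempty_imageAffine hc
  obtain ⟨L⟩ := nonempty_intensity hκ
  exact ⟨Real.iInf_nonneg fun x => (distWith_mem _ _ _ _).1,
    (imageDist_le T L M₁ M₂).trans (distWith_mem _ _ _ _).2⟩

/-- The minimum of good estimates over a good net is a good estimate of the minimum. -/
theorem abs_fold_min_sub_imageDist_le {c κ : ℝ} (hc : 1 ≤ c) (hκ : 1 ≤ κ) {n : ℕ}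
    (M₁ M₂ : GrayImage n) (N : Finset (ImageAffine c × Intensity κ)) {ε ρ : ℝ} (hε : 0 ≤ ε)
    (hρ : 0 ≤ ρ) (hN : ∀ (T : ImageAffine c) (L : Intensity κ), distWith T L M₁ M₂ = 1 ∨
      ∃ x ∈ N, |distWith T L M₁ M₂ - distWith x.1 x.2 M₁ M₂| ≤ ρ)
    (g : ImageAffine c × Intensity κ → ℝ)
    (hg : ∀ x ∈ N, |g x - distWith x.1 x.2 M₁ M₂| ≤ ε) :
    |N.fold min 1 g - imageDist c κ M₁ M₂| ≤ ρ + ε := by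
  obtain ⟨T₀⟩ := nonempty_imageAffine hc
  obtain ⟨L₀⟩ := nonempty_intensity hκ
  have : Nonempty (ImageAffine c × Intensity κ) := ⟨(T₀, L₀)⟩
  rw [abs_le]
  constructor
  · have : imageDist c κ M₁ M₂ - ε ≤ N.fold min 1 g := by
      rw [Finset.le_fold_min]
      refine ⟨by linarith [(imageDist_mem hc hκ M₁ M₂).2], fun x hx => ?_⟩
      linarith [imageDist_le x.1 x.2 M₁ M₂, (abs_le.1 (hg x hx)).1]
    linarith
  · have : N.fold min 1 g - (ρ + ε) ≤ imageDist c κ M₁ M₂ := le_ciInf fun x => by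
      rw [sub_le_iff_le_add, Finset.fold_min_le]
      -- The initial value `1` of the fold stands in for the transformations of distance `1`, which
      -- the net need not approximate.
      rcases hN x.1 x.2 with h | ⟨y, hy, h⟩
      · left; linarith
      · right
        exact ⟨y, hy, by linarith [(abs_le.1 (hg y hy)).2, (abs_le.1 h).1]⟩
    linarith

/-! ### The algorithms -/

/-- Querying everything. -/
theorem exists_exact_alg (c κ : ℝ) (n : ℕ) :
    ∃ alg : QueryAlg n, alg.QueriesAtMost (2 * n ^ 2) ∧
      ∀ M₁ M₂, alg.run M₁ M₂ = PMF.pure (imageDist c κ M₁ M₂) := by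
  obtain ⟨alg, hq, h⟩ := QueryAlg.exists_run_eq_pure (fun M₁ M₂ => imageDist c κ M₁ M₂)
    (Finset.univ : Finset (Bool × Pixel n)).toList fun M₁ M₂ N₁ N₂ h₁ h₂ => by
      rw [funext fun p => h₁ p (by simp), funext fun p => h₂ p (by simp)]
  refine ⟨alg, ?_, h⟩
  rwa [Finset.length_toList, Finset.card_univ, Fintype.card_prod, card_pixel,
    Fintype.card_bool] at hq

/-- Estimating the distances for finitely many transformations with a common random sample of
pixels, and returning their minimum. -/
theorem exists_sampling_alg {c κ : ℝ} {n : ℕ} (hn : 0 < n)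
    (N : Finset (ImageAffine c × Intensity κ)) {S : ℕ} (hS : 0 < S) {ε : ℝ} (hε : 0 < ε)
    (hε1 : ε ≤ 1) :
    ∃ alg : QueryAlg n, alg.QueriesAtMost (S + N.card * S) ∧
      ∀ (M₁ M₂ : GrayImage n) (E : Set ℝ), MeasurableSet E →
        (∀ g : ImageAffine c × Intensity κ → ℝ,
          (∀ x ∈ N, |g x - distWith x.1 x.2 M₁ M₂| ≤ ε) → N.fold min 1 g ∈ E) →
        1 - N.card * (2 * Real.exp (-(ε ^ 2 * S / 4))) ≤ (alg.run M₁ M₂).toMeasure.real E := by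
  classical
  have : Nonempty (Pixel n) := by
    rw [← Fintype.card_pos_iff, card_pixel]; positivity
  let est : (Fin S → Pixel n) → GrayImage n → GrayImage n → ImageAffine c × Intensity κ → ℝ :=
    fun s M₁ M₂ x => (∑ i, costAt x.2 (M₁ (s i)) M₂ (x.1.apply (s i).1)) / S
  obtain ⟨alg, hq, h⟩ := QueryAlg.exists_random (S + N.card * S)
    (fun (s : Fin S → Pixel n) M₁ M₂ => N.fold min 1 (est s M₁ M₂)) fun s => by
      -- A sample mapped outside the image needs no second value; querying `s y.2` is then a dummy
      -- that keeps the list length at `N.card * S`.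
      let target : (ImageAffine c × Intensity κ) × Fin S → Pixel n := fun y =>
        if h : y.1.1.apply (s y.2).1 ∈ pixels n then ⟨_, h⟩ else s y.2
      have := QueryAlg.exists_run_eq_pure (fun M₁ M₂ => N.fold min 1 (est s M₁ M₂))
        ((Finset.univ : Finset (Fin S)).toList.map (fun i => (false, s i)) ++
          (N ×ˢ (Finset.univ : Finset (Fin S))).toList.map fun y => (true, target y))
        fun M₁ M₂ N₁ N₂ h₁ h₂ => by
          refine Finset.fold_congr fun x hx => ?_
          refine congrArg (· / (S : ℝ)) (Finset.sum_congr rfl fun i _ => ?_)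
          rw [h₁ (s i) (by simp)]
          unfold costAt
          split_ifs with hp
          · rw [h₂ ⟨_, hp⟩]
            refine List.mem_append_right _ (List.mem_map.2 ⟨(x, i), by simp [hx], ?_⟩)
            simp [target, hp]
          · rfl
      simpa using this
  refine ⟨alg, hq, fun M₁ M₂ E hE hgood => ?_⟩
  rw [h M₁ M₂ E hE, le_div_iff₀ (by exact_mod_cast Fintype.card_pos)]
  have hbad : ∀ x ∈ N, ((Finset.univ.filter fun s : Fin S → Pixel n =>
      ¬ |est s M₁ M₂ x - distWith x.1 x.2 M₁ M₂| ≤ ε).card : ℝ) ≤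
      (Fintype.card (Pixel n) : ℝ) ^ S * (2 * Real.exp (-(ε ^ 2 * S / 4))) := fun x _ => by
    have hx := card_sample_mean_deviation_le
      (fun p : Pixel n => costAt x.2 (M₁ p) M₂ (x.1.apply p.1))
      (fun p => costAt_mem _ (M₁ p).2 _ _) hS hε hε1
    have e : distWith x.1 x.2 M₁ M₂ =
        (∑ p : Pixel n, costAt x.2 (M₁ p) M₂ (x.1.apply p.1)) / Fintype.card (Pixel n) := by
      rw [distWith_eq, card_pixel, one_div_mul_eq_div]; push_cast; rfl
    rw [e]
    exact hx
  -- Union bound: every sample leads to `E` or is bad for some member of the net.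
  have hsub : (Finset.univ : Finset (Fin S → Pixel n)) ⊆
      (Finset.univ.filter fun s => N.fold min 1 (est s M₁ M₂) ∈ E) ∪
      N.biUnion fun x => Finset.univ.filter fun s =>
        ¬ |est s M₁ M₂ x - distWith x.1 x.2 M₁ M₂| ≤ ε := fun s _ => by
    by_cases hs : ∀ x ∈ N, |est s M₁ M₂ x - distWith x.1 x.2 M₁ M₂| ≤ ε
    · exact Finset.mem_union_left _ (Finset.mem_filter.2 ⟨Finset.mem_univ _, hgood _ hs⟩)
    · push Not at hs
      obtain ⟨x, hx, hs⟩ := hs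
      exact Finset.mem_union_right _ (Finset.mem_biUnion.2
        ⟨x, hx, Finset.mem_filter.2 ⟨Finset.mem_univ _, hs.not_ge⟩⟩)
  have hcard := (Finset.card_le_card hsub).trans (Finset.card_union_le _ _)
  have hcard' := hcard.trans (Nat.add_le_add_left Finset.card_biUnion_le _)
  rw [Finset.card_univ] at hcard'
  have hreal : (Fintype.card (Fin S → Pixel n) : ℝ) ≤
      (Finset.univ.filter fun s => N.fold min 1 (est s M₁ M₂) ∈ E).card +
      ∑ x ∈ N, ((Finset.univ.filter fun s : Fin S → Pixel n =>
        ¬ |est s M₁ M₂ x - distWith x.1 x.2 M₁ M₂| ≤ ε).card : ℝ) := by exact_mod_cast hcard'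
  have hsum := Finset.sum_le_sum hbad
  rw [Finset.sum_const, nsmul_eq_mul] at hsum
  have hpow : (Fintype.card (Fin S → Pixel n) : ℝ) = (Fintype.card (Pixel n) : ℝ) ^ S := by
    simp
  rw [hpow] at hreal ⊢
  linarith

theorem measurableSet_abs_sub_le (a r : ℝ) : MeasurableSet {d : ℝ | |d - a| ≤ r} :=
  (isClosed_le (by fun_prop) continuous_const).measurableSet

theorem toMeasure_pure_real_of_mem {a : ℝ} {E : Set ℝ} (hE : MeasurableSet E) (ha : a ∈ E) :
    (PMF.pure a).toMeasure.real E = 1 := by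
  rw [MeasureTheory.measureReal_def, PMF.toMeasure_pure_apply _ _ hE, if_pos ha,
    ENNReal.toReal_one]

end ImageMatching

/-! ### Choice of parameters and the final case distinction. -/

open ImageMatching in
/-- The sampling algorithm over a net, for small parameters and images that are not too small. -/
theorem ImageMatching.exists_alg_of_small {c κ : ℝ} (hc : 1 ≤ c) (hκ : 1 ≤ κ) {η : ℝ} (hη : 0 < η)
    (hη1 : η < 1) {n : ℕ} {δ ε : ℝ} (hn : 0 < n) (hδ : 0 < δ) (hε : 0 < ε) (hε1 : ε ≤ 1)
    (hδc : 8 * c * δ ≤ 1) (hδn : 1 ≤ δ * n) {G : ℝ} (hG : G = (2 * (2 + 2 * c + κ) + 3) ^ 8) :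
    ∃ alg : QueryAlg n,
      (∃ q : ℕ, (q : ℝ) ≤ 2 * G * (4 * Real.log (2 * G / η) + 6) * (1 / (ε ^ 2 * δ ^ 8)) *
          Real.log (2 + 1 / (ε ^ 2 * δ ^ 8)) ∧ alg.QueriesAtMost q) ∧
      ∀ (B : ℝ) (M₁ M₂ : GrayImage n), perimeterSize M₂ ≤ B * n →
        1 - η ≤ (alg.run M₁ M₂).toMeasure.real
          {d : ℝ | |d - imageDist c κ M₁ M₂| ≤
            (8 * κ * (8 * c + 1) ^ 2 * B + 2) * δ + ε} := by
  have hn' : (0 : ℝ) < n := by exact_mod_cast hn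
  have hδ1 : δ ≤ 1 := by nlinarith
  obtain ⟨N, hcard, hN⟩ := exists_transformation_net hc hκ hn hδ hδc hδn
  have hG1 : 1 ≤ G := by rw [hG]; exact one_le_pow₀ (by linarith)
  have hδ8 : δ ^ 8 ≤ 1 := pow_le_one₀ hδ.le hδ1
  have hcardG : (N.card : ℝ) ≤ G / δ ^ 8 := by
    refine hcard.trans ?_
    rw [hG, ← div_pow]
    refine pow_le_pow_left₀ (by positivity) ?_ 8
    rw [add_div]
    gcongr
    rw [le_div_iff₀ hδ]
    linarith
  set X := 1 / (ε ^ 2 * δ ^ 8) with hX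
  set l := Real.log (2 * G / η) with hl
  have hl0 : 0 ≤ l := Real.log_nonneg (by rw [le_div_iff₀ hη]; linarith)
  have hXδ : 1 / δ ^ 8 ≤ X := by
    rw [hX]
    have : ε ^ 2 ≤ 1 := pow_le_one₀ hε.le hε1
    exact one_div_le_one_div_of_le (by positivity)
      (mul_le_of_le_one_left (by positivity) this)
  have hδ8' : 1 ≤ 1 / δ ^ 8 := by rwa [le_div_iff₀ (by positivity), one_mul]
  have hlog : 1 ≤ Real.log (2 + X) := by
    rw [Real.le_log_iff_exp_le (by linarith)]
    linarith [Real.exp_one_lt_d9]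
  set ℓ := Real.log (2 + X) with hℓ
  set Y := 2 * G / η * (1 / δ ^ 8) with hY
  have hY0 : 0 < Y := by positivity
  have hlogY : Real.log Y ≤ (l + 1) * ℓ := by
    rw [hY, Real.log_mul (by positivity) (by positivity), ← hl]
    have : Real.log (1 / δ ^ 8) ≤ ℓ := Real.log_le_log (by positivity) (by linarith)
    nlinarith
  have hlogY0 : 0 ≤ Real.log Y := by
    rw [hY, Real.log_mul (by positivity) (by positivity), ← hl]
    exact add_nonneg hl0 (Real.log_nonneg hδ8')
  -- This makes `exp (-(ε ^ 2 * S / 4)) ≤ 1 / Y`; the extra `1` ensures `0 < S`. Rounding and this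
  -- `1` cost at most `2 ≤ 2 * (ℓ / ε ^ 2)`, which turns `4 * l + 4` into `4 * l + 6`.
  set S : ℕ := ⌈4 * Real.log Y / ε ^ 2⌉₊ + 1 with hS
  have hS0 : 0 < S := Nat.succ_pos _
  have hSle : (S : ℝ) ≤ (4 * l + 6) * ℓ / ε ^ 2 := by
    have h1 := (Nat.ceil_lt_add_one (show 0 ≤ 4 * Real.log Y / ε ^ 2 by positivity)).le
    have h2 : (1 : ℝ) ≤ ℓ / ε ^ 2 := by
      rw [le_div_iff₀ (by positivity), one_mul]
      exact (pow_le_one₀ hε.le hε1).trans hlog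
    have h3 : 4 * Real.log Y / ε ^ 2 ≤ 4 * ((l + 1) * ℓ) / ε ^ 2 := by gcongr
    have h4 : (4 * l + 6) * ℓ / ε ^ 2 = 4 * ((l + 1) * ℓ) / ε ^ 2 + 2 * (ℓ / ε ^ 2) := by ring
    rw [hS]
    push_cast
    linarith
  have hSge : Real.log Y ≤ ε ^ 2 * S / 4 := by
    have h1 : 4 * Real.log Y / ε ^ 2 ≤ S := by
      rw [hS]; push_cast; linarith [Nat.le_ceil (4 * Real.log Y / ε ^ 2)]
    rw [div_le_iff₀ (by positivity)] at h1
    linarith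
  obtain ⟨alg, hq, halg⟩ := exists_sampling_alg hn N hS0 hε hε1
  refine ⟨alg, ⟨S + N.card * S, ?_, hq⟩, fun B M₁ M₂ hB => ?_⟩
  · have h1 : 1 ≤ G / δ ^ 8 := by rw [le_div_iff₀ (by positivity)]; linarith
    push_cast
    calc (S : ℝ) + N.card * S = (1 + N.card) * S := by ring
      _ ≤ (G / δ ^ 8 + G / δ ^ 8) * ((4 * l + 6) * ℓ / ε ^ 2) := by gcongr
      _ = _ := by rw [hX]; field_simp; ring
  · have hB0 : 0 ≤ B := nonneg_of_mul_nonneg_left ((perimeterSize_nonneg M₂).trans hB) hn'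
    refine le_trans ?_ (halg M₁ M₂ _ (measurableSet_abs_sub_le _ _) fun g hg =>
      abs_fold_min_sub_imageDist_le hc hκ M₁ M₂ N hε.le (by positivity)
        (fun T L => hN T L B M₁ M₂ hB) g hg)
    have h1 : Real.exp (-(ε ^ 2 * S / 4)) ≤ 1 / Y := by
      rw [Real.exp_neg, ← one_div]
      refine one_div_le_one_div_of_le hY0 ?_
      rwa [← Real.log_le_iff_le_exp hY0]
    have h2 : N.card * (2 * Real.exp (-(ε ^ 2 * S / 4))) ≤ η := by
      calc N.card * (2 * Real.exp (-(ε ^ 2 * S / 4))) ≤ G / δ ^ 8 * (2 * (1 / Y)) := by gcongr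
        _ = η := by rw [hY]; field_simp
    linarith

/-- `c` bounds the scaling factor of the affine maps and `κ` the contrast; `K B` is the constant
of the additive error for images with perimeter size at most `B * n`; `1 - η` is the probability
of success; the query bound is `X` times a power of `log X`, where `X = 1 / (ε ^ 2 * δ ^ 8)`. -/
theorem mainTheorem4 (c κ : ℝ) (hc : 1 ≤ c) (hκ : 1 ≤ κ) :
    ∃ K : ℝ → ℝ, ∀ η : ℝ, 0 < η → η < 1 →
      ∃ (C : ℝ) (k : ℕ), ∀ (n : ℕ) (δ ε : ℝ), 0 < n → 0 < δ → 0 < ε →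
        ∃ alg : ImageMatching.QueryAlg n,
          (∃ q : ℕ,
            (q : ℝ) ≤ C * (1 / (ε ^ 2 * δ ^ 8)) * Real.log (2 + 1 / (ε ^ 2 * δ ^ 8)) ^ k ∧
            alg.QueriesAtMost q) ∧
          ∀ (B : ℝ) (M₁ M₂ : ImageMatching.GrayImage n),
            ImageMatching.perimeterSize M₁ ≤ B * n →
            ImageMatching.perimeterSize M₂ ≤ B * n →
            1 - η ≤ (alg.run M₁ M₂).toMeasure.real
              {d : ℝ | |d - ImageMatching.imageDist c κ M₁ M₂| ≤ K B * (δ + ε)} := by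
  open ImageMatching in
  -- The summand `8 * c` makes the allowed error at least `1` when `1 < ε` or `1 < 8 * c * δ`, so
  -- that the output `0` is admissible. The absolute value keeps the constant nonnegative for every
  -- `B`.
  refine ⟨fun B => 8 * κ * (8 * c + 1) ^ 2 * |B| + 8 * c + 2, fun η hη hη1 => ?_⟩
  obtain ⟨G, hG⟩ : ∃ G : ℝ, G = (2 * (2 + 2 * c + κ) + 3) ^ 8 := ⟨_, rfl⟩
  have hG1 : 1 ≤ G := by rw [hG]; exact one_le_pow₀ (by linarith)
  have hl : 0 ≤ Real.log (2 * G / η) := Real.log_nonneg (by rw [le_div_iff₀ hη]; linarith)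
  refine ⟨2 * G * (4 * Real.log (2 * G / η) + 6), 1, fun n δ ε hn hδ hε => ?_⟩
  have hn' : (0 : ℝ) < n := by exact_mod_cast hn
  have hK : ∀ B : ℝ, 0 ≤ 8 * κ * (8 * c + 1) ^ 2 * |B| := fun B => by positivity
  rw [pow_one]
  by_cases hlarge : 1 < ε ∨ 1 < 8 * c * δ
  · refine ⟨.output 0, ⟨0, ?_, trivial⟩, fun B M₁ M₂ _ _ => ?_⟩
    · have : 0 ≤ Real.log (2 + 1 / (ε ^ 2 * δ ^ 8)) := Real.log_nonneg (by
        have : 0 ≤ 1 / (ε ^ 2 * δ ^ 8) := by positivity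
        linarith)
      push_cast
      positivity
    · have h0 := imageDist_mem hc hκ M₁ M₂
      change 1 - η ≤ (PMF.pure (0 : ℝ)).toMeasure.real _
      rw [toMeasure_pure_real_of_mem (measurableSet_abs_sub_le _ _)]
      · linarith
      · rw [Set.mem_ofPred_eq, zero_sub, abs_neg, abs_of_nonneg h0.1]
        refine h0.2.trans ?_
        have h1 : 1 ≤ 8 * c * (δ + ε) := by
          rcases hlarge with h | h
          · nlinarith
          · nlinarith [mul_pos (show 0 < 8 * c by linarith) hε]
        nlinarith [mul_nonneg (hK B) (add_pos hδ hε).le]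
  push Not at hlarge
  obtain ⟨hε1, hδc⟩ := hlarge
  have hδ1 : δ ≤ 1 := by nlinarith
  -- If `δ * n < 1`, then `n ^ 2 ≤ 1 / (ε ^ 2 * δ ^ 8)`, so querying all `2 * n ^ 2` values is
  -- affordable.
  rcases le_or_gt 1 (δ * n) with hδn | hδn
  · obtain ⟨alg, hq, h⟩ := exists_alg_of_small hc hκ hη hη1 hn hδ hε hε1 hδc hδn hG
    refine ⟨alg, hq, fun B M₁ M₂ _ hB => (h B M₁ M₂ hB).trans ?_⟩
    refine MeasureTheory.measureReal_mono fun d hd => ?_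
    rw [Set.mem_ofPred_eq] at hd ⊢
    refine hd.trans ?_
    have h1 : 8 * κ * (8 * c + 1) ^ 2 * B ≤ 8 * κ * (8 * c + 1) ^ 2 * |B| := by
      gcongr; exact le_abs_self B
    nlinarith [mul_nonneg (hK B) hε.le, mul_le_mul_of_nonneg_right h1 hδ.le,
      mul_pos (show 0 < c by linarith) hδ, mul_pos (show 0 < c by linarith) hε]
  · obtain ⟨alg, hq, h⟩ := exists_exact_alg c κ n
    refine ⟨alg, ⟨2 * n ^ 2, ?_, hq⟩, fun B M₁ M₂ _ _ => ?_⟩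
    · have hX : (n : ℝ) ^ 2 ≤ 1 / (ε ^ 2 * δ ^ 8) := by
        rw [le_div_iff₀ (by positivity)]
        calc (n : ℝ) ^ 2 * (ε ^ 2 * δ ^ 8) = (δ * n) ^ 2 * (ε ^ 2 * δ ^ 6) := by ring
          _ ≤ 1 * (1 * 1) := by
            gcongr
            · exact pow_le_one₀ (by positivity) hδn.le
            · exact pow_le_one₀ hε.le hε1
            · exact pow_le_one₀ hδ.le hδ1
          _ = 1 := by norm_num
      have hX1 : 1 ≤ 1 / (ε ^ 2 * δ ^ 8) :=
        (one_le_pow₀ (by exact_mod_cast hn)).trans hX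
      have hlog : 1 ≤ Real.log (2 + 1 / (ε ^ 2 * δ ^ 8)) := by
        rw [Real.le_log_iff_exp_le (by linarith)]
        linarith [Real.exp_one_lt_d9]
      push_cast
      calc 2 * (n : ℝ) ^ 2 = 2 * 1 * 1 * (n : ℝ) ^ 2 * 1 := by ring
        _ ≤ 2 * G * (4 * Real.log (2 * G / η) + 6) * (1 / (ε ^ 2 * δ ^ 8)) *
            Real.log (2 + 1 / (ε ^ 2 * δ ^ 8)) := by
          gcongr
          linarith
    · rw [h, toMeasure_pure_real_of_mem (measurableSet_abs_sub_le _ _)]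
      · linarith
      · rw [Set.mem_ofPred_eq, sub_self, abs_zero]
        have := hK B
        positivity
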